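/- Let $\ell^2$ be the complex Hilbert space of square-summable complex sequences $\mathbf z=(z_j)_{j\ge 1}$, $z_j=x_j+\sqrt{-1}\,y_j$, and let $V\subset\ell^2$ be a nonempty open set. A subset $S\subset V$ is called uniformly included in $V$ if it is bounded and $d(S,\partial V)>0$, where $d(S,\partial V)=\inf\{\|\mathbf z-\mathbf w\|:\mathbf z\in S,\ \mathbf w\in\partial V\}$, with $\inf\emptyset=+\infty$ (so $d(S,\partial V)=+\infty$ if $V=\ell^2$ or $S=\emptyset$). For $k\ge 0$, $C^k(V)$ is the set of functions $f:V\to\mathbb C$ such that all partial derivatives of $f$ of order at most $k$ with respect to the real coordinates $x_j,y_j$ $(j\ge 1)$, including $f$ itself, exist and are continuous on $V$; and $C^\infty(V)=\bigcap_k C^k(V)$. Put $\partial_j=\frac12\big(\frac{\partial}{\partial x_j}-\sqrt{-1}\frac{\partial}{\partial y_j}\big)$ and $\overline\partial_j=\frac12\big(\frac{\partial}{\partial x_j}+\sqrt{-1}\frac{\partial}{\partial y_j}\big)$, and, for finitely supported sequences $\alpha,\beta$ of nonnegative integers, $\partial_\alpha=\partial_1^{\alpha_1}\partial_2^{\alpha_2}\cdots$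 and $\overline\partial_\beta=\overline\partial_1^{\beta_1}\overline\partial_2^{\beta_2}\cdots$. Let $C^1_F(V)$ be the set of $f\in C^1(V)$ such that $$\sup_{S}\Big\{|f|+\sum_{j=1}^\infty\big(|\partial_j f|^2+|\overline\partial_j f|^2\big)\Big\}<\infty$$ for every $S$ uniformly included in $V$, and let $C^\infty_{F^\infty}(V)$ be the set of $f\in C^\infty(V)$ such that $\partial_\alpha\overline\partial_\beta f\in C^1_F(V)$ for all $\alpha,\beta$. **Theorem.** There exists a real-valued function $\eta\in C^\infty_{F^\infty}(V)$ that is an exhaustion function on $V$, i.e. for every $t\in\mathbb R$ the sublevel set $\{\mathbf z\in V:\eta(\mathbf z)\le t\}$ is uniformly included in $V$. -/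

import Mathlib

open scoped ENNReal

noncomputable section

/-- The complex Hilbert space of square-summable complex sequences (indexed from `0`). -/
abbrev EllTwo : Type := lp (fun _ : ℕ => ℂ) 2

/-- The real coordinate direction of `x_j` (for `false`, the vector `e_j`) and of `y_j`
(for `true`, the vector `i • e_j`), where `z_j = x_j + i y_j`. -/
def coordDir (d : ℕ × Bool) : EllTwo :=
  lp.single 2 d.1 (if d.2 then Complex.I else 1)

/-- The partial derivative of `f` with respect to the real coordinate `x_j` or `y_j`, that is,
the limit of `(f (z + τ v) - f z) / τ` as the real number `τ` tends to `0`. -/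
def realPartial (d : ℕ × Bool) (f : EllTwo → ℂ) : EllTwo → ℂ :=
  fun z => lineDeriv ℝ f z (coordDir d)

/-- The iterated partial derivative along a finite list of real coordinates;
the head of the list is differentiated last. -/
def iterRealPartial : List (ℕ × Bool) → (EllTwo → ℂ) → (EllTwo → ℂ)
  | [], f => f
  | d :: l, f => realPartial d (iterRealPartial l f)

/-- `f ∈ C^k(V)`: all partial derivatives of `f` of order at most `k` (including `f` itself)
exist and are continuous on `V`. Only the values of `f` on the open set `V` matter. -/
def IsCk (k : ℕ) (V : Set EllTwo) (f : EllTwo → ℂ) : Prop :=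
  (∀ l : List (ℕ × Bool), l.length < k → ∀ d : ℕ × Bool, ∀ z ∈ V,
      LineDifferentiableAt ℝ (iterRealPartial l f) z (coordDir d)) ∧
  ∀ l : List (ℕ × Bool), l.length ≤ k → ContinuousOn (iterRealPartial l f) V

/-- `f ∈ C^∞(V)`, the intersection of all `C^k(V)`. -/
def IsCInfty (V : Set EllTwo) (f : EllTwo → ℂ) : Prop :=
  ∀ k : ℕ, IsCk k V f

/-- `∂_j = (∂/∂x_j - i ∂/∂y_j) / 2`. -/
def wirt (j : ℕ) (f : EllTwo → ℂ) : EllTwo → ℂ :=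
  fun z => (1 / 2 : ℂ) * (realPartial (j, false) f z - Complex.I * realPartial (j, true) f z)

/-- `∂̄_j = (∂/∂x_j + i ∂/∂y_j) / 2`. -/
def wirtBar (j : ℕ) (f : EllTwo → ℂ) : EllTwo → ℂ :=
  fun z => (1 / 2 : ℂ) * (realPartial (j, false) f z + Complex.I * realPartial (j, true) f z)

/-- `∂_α = ∂_{j₁}^{α_{j₁}} ∂_{j₂}^{α_{j₂}} ⋯ ∂_{jₙ}^{α_{jₙ}}`, where `j₁ < ⋯ < jₙ` are the indices
in the support of the finitely supported multi-index `α`. -/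
def wirtMulti (α : ℕ →₀ ℕ) (f : EllTwo → ℂ) : EllTwo → ℂ :=
  (α.support.sort (· ≤ ·)).foldr (fun j g => (wirt j)^[α j] g) f

/-- `∂̄_β = ∂̄_{j₁}^{β_{j₁}} ∂̄_{j₂}^{β_{j₂}} ⋯ ∂̄_{jₙ}^{β_{jₙ}}`, with `j₁ < ⋯ < jₙ` the indices
in the support of `β`. -/
def wirtBarMulti (β : ℕ →₀ ℕ) (f : EllTwo → ℂ) : EllTwo → ℂ :=
  (β.support.sort (· ≤ ·)).foldr (fun j g => (wirtBar j)^[β j] g) f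

/-- `S` is uniformly included in `V`: it is a bounded subset of `V` with `d(S, ∂V) > 0`. The
distance is taken in `[0, ∞]`, so it is `∞` when `∂V = ∅`, that is, when `V` is the whole space,
and the empty set is uniformly included in `V`. -/
def UniformlyIncluded (S V : Set EllTwo) : Prop :=
  S ⊆ V ∧ Bornology.IsBounded S ∧ 0 < ⨅ z ∈ S, ⨅ w ∈ frontier V, edist z w

/-- `f ∈ C^1_F(V)`: `f ∈ C^1(V)` and `|f| + ∑_j (|∂_j f|² + |∂̄_j f|²)` is bounded on every set
that is uniformly included in `V`; the sum and the supremum are taken in `[0, ∞]`. -/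
def IsC1F (V : Set EllTwo) (f : EllTwo → ℂ) : Prop :=
  IsCk 1 V f ∧ ∀ S : Set EllTwo, UniformlyIncluded S V →
    ⨆ z ∈ S, (‖f z‖ₑ + ∑' j : ℕ, (‖wirt j f z‖ₑ ^ 2 + ‖wirtBar j f z‖ₑ ^ 2)) < ∞

/-- `f ∈ C^∞_{F^∞}(V)`: `f ∈ C^∞(V)` and `∂_α ∂̄_β f ∈ C^1_F(V)` for all multi-indices. -/
def IsCInftyFInfty (V : Set EllTwo) (f : EllTwo → ℂ) : Prop :=
  IsCInfty V f ∧ ∀ α β : ℕ →₀ ℕ, IsC1F V (wirtMulti α (wirtBarMulti β f))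

/-- `η` is an exhaustion function on `V`: all its sublevel sets are uniformly included in `V`. -/
def IsExhaustion (V : Set EllTwo) (η : EllTwo → ℝ) : Prop :=
  ∀ t : ℝ, UniformlyIncluded {z | z ∈ V ∧ η z ≤ t} V

end

open MeasureTheory Filter Topology Function
open scoped NNReal

/-! Lipschitz functions on `EllTwo` can be smoothed by averaging over an infinite-dimensional box
spanned by a summable family of multiples of the coordinate vectors. The derivative along a side `w
i` is the average, over the box without that side, of the difference `f (x + w i) - f x`, which is
again Lipschitz (`hasLineDerivAt_boxAverage`). Since each coordinate direction occurs infinitely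
often among the sides, this can be repeated forever: every iterated partial exists and is Lipschitz
(`IsSpanningFamily.hasLipschitzPartials`).

A Lipschitz constant `K` bounds the derivative in every finitely supported direction, hence by
duality the square sum of all first partials (`HasLipschitzPartials.tsum_wirt_le`). Applied to each
derivative, this yields the `F^∞` bounds.

The exhaustion is a smoothed norm plus a series of smoothed cutoffs concentrated ever closer to
`frontier V`. The norm makes sublevel sets bounded, the cutoffs keep them away from the frontier,
and on each uniformly included set only finitely many cutoffs are nonzero. -/

noncomputable section

/-! ### Averages over infinite-dimensional boxes. -/

section BoxAverage

variable {ι E F : Type*} [NormedAddCommGroup E] [NormedSpace ℝ E]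
  [NormedAddCommGroup F] [NormedSpace ℝ F]

/-- The uniform probability measure on the cube `[0, 1]^ι`. -/
def cubeMeasure (ι : Type*) : Measure (ι → unitInterval) :=
  Measure.infinitePi fun _ => volume

instance : IsProbabilityMeasure (cubeMeasure ι) := by
  unfold cubeMeasure; infer_instance

/-- The point `∑ ω_i w_i` of the box spanned by the vectors `w_i`. -/
def cubeSum (w : ι → E) (ω : ι → unitInterval) : E :=
  ∑' i, (ω i : ℝ) • w i

/-- The average of `f` over the box with corner `z` spanned by the vectors `w_i`. -/
def boxAverage (w : ι → E) (f : E → F) (z : E) : F :=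
  ∫ ω, f (z + cubeSum w ω) ∂cubeMeasure ι

theorem norm_unitInterval_smul_le (t : unitInterval) (v : E) : ‖(t : ℝ) • v‖ ≤ ‖v‖ := by
  rw [norm_smul, Real.norm_of_nonneg t.2.1]
  exact mul_le_of_le_one_left (norm_nonneg _) t.2.2

theorem norm_cubeSum_le {w : ι → E} (hw : Summable fun i => ‖w i‖) (ω : ι → unitInterval) :
    ‖cubeSum w ω‖ ≤ ∑' i, ‖w i‖ :=
  tsum_of_norm_bounded hw.hasSum fun i => norm_unitInterval_smul_le (ω i) (w i)

theorem summable_norm_update [DecidableEq ι] {E : Type*} [NormedAddCommGroup E]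
    {w : ι → E} (hw : Summable fun i => ‖w i‖) (i : ι) :
    Summable fun j => ‖update w i 0 j‖ := by
  refine hw.of_nonneg_of_le (fun _ => norm_nonneg _) fun j => ?_
  rcases eq_or_ne j i with rfl | h
  · simp
  · simp [h]

/-- Resampling one coordinate independently does not change a product measure. This gives Fubini in
one coordinate without splitting the index type. -/
theorem measurePreserving_update_cube [DecidableEq ι] (i : ι) :
    MeasurePreserving (fun p : (ι → unitInterval) × unitInterval => update p.1 i p.2)
      ((cubeMeasure ι).prod volume) (cubeMeasure ι) := by
  have hm : Measurable fun p : (ι → unitInterval) × unitInterval => update p.1 i p.2 := by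
    refine measurable_pi_lambda _ fun j => ?_
    rcases eq_or_ne j i with rfl | h
    · simpa using measurable_snd
    · simp only [update_of_ne h]
      fun_prop
  refine ⟨hm, Measure.eq_infinitePi _ fun s t ht => ?_⟩
  have hs : MeasurableSet (Set.pi (s : Set ι) t) := .pi s.countable_toSet fun j _ => ht j
  have hpre : (fun p : (ι → unitInterval) × unitInterval => update p.1 i p.2) ⁻¹'
      (Set.pi (s : Set ι) t) =
      (Set.pi ((s.erase i : Finset ι) : Set ι) t) ×ˢ (if i ∈ s then t i else Set.univ) := by
    ext ⟨ω, x⟩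
    simp only [Set.mem_preimage, Set.mem_pi, Finset.mem_coe, Finset.mem_erase, Set.mem_prod]
    constructor
    · intro h
      refine ⟨fun j hj => by simpa [hj.1] using h j hj.2, ?_⟩
      split_ifs with hi
      · simpa using h i hi
      · trivial
    · rintro ⟨h1, h2⟩ j hj
      rcases eq_or_ne j i with rfl | hji
      · simpa [hj] using h2
      · simpa [hji] using h1 j ⟨hji, hj⟩
  rw [Measure.map_apply hm hs, hpre, Measure.prod_prod, cubeMeasure,
    Measure.infinitePi_pi _ fun j _ => ht j]
  split_ifs with hi
  · exact Finset.prod_erase_mul s (fun j => volume (t j)) hi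
  · simp [Finset.erase_eq_of_notMem hi]

theorem integral_unitInterval_eq (g : ℝ → F) :
    ∫ t : unitInterval, g t = ∫ t in (0 : ℝ)..1, g t := by
  rw [unitInterval.measurePreserving_coe.integral_comp unitInterval.measurableEmbedding_coe g,
    intervalIntegral.integral_of_le zero_le_one, integral_Icc_eq_integral_Ioc]

variable [CompleteSpace E]

theorem continuous_cubeSum {w : ι → E} (hw : Summable fun i => ‖w i‖) :
    Continuous (cubeSum w) :=
  continuous_tsum (fun i => by fun_prop) hw fun i ω => norm_unitInterval_smul_le (ω i) (w i)

theorem cubeSum_update [DecidableEq ι] {w : ι → E} (hw : Summable fun i => ‖w i‖) (i : ι)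
    (ω : ι → unitInterval) (t : unitInterval) :
    cubeSum w (update ω i t) = cubeSum (update w i 0) ω + (t : ℝ) • w i := by
  have h1 : Summable fun j => (ω j : ℝ) • update w i 0 j :=
    .of_norm_bounded (summable_norm_update hw i) fun j => norm_unitInterval_smul_le _ _
  have h2 := (hasSum_ite_eq i ((t : ℝ) • w i))
  refine (HasSum.congr_fun (h1.hasSum.add h2) fun j => ?_).tsum_eq
  rcases eq_or_ne j i with rfl | h
  · simp
  · simp [h]

variable [Countable ι]

theorem integrable_comp_cubeSum {F : Type*} [NormedAddCommGroup F]
    {w : ι → E} (hw : Summable fun i => ‖w i‖) {f : E → F}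
    (hf : Continuous f) (z : E) :
    Integrable (fun ω => f (z + cubeSum w ω)) (cubeMeasure ι) := by
  have := continuous_cubeSum hw
  exact Continuous.integrable_of_hasCompactSupport (by fun_prop) (.of_compactSpace _)

theorem LipschitzWith.boxAverage {w : ι → E} (hw : Summable fun i => ‖w i‖) {f : E → F}
    {K : ℝ≥0} (hf : LipschitzWith K f) : LipschitzWith K (boxAverage w f) := by
  refine LipschitzWith.of_dist_le_mul fun x y => ?_
  rw [dist_eq_norm]
  unfold _root_.boxAverage
  rw [← integral_sub (integrable_comp_cubeSum hw hf.continuous x)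
    (integrable_comp_cubeSum hw hf.continuous y)]
  refine (norm_integral_le_of_norm_le_const (C := K * dist x y) (ae_of_all _ fun ω => ?_)).trans
    (by simp)
  rw [← dist_eq_norm]
  simpa using hf.dist_le_mul (x + cubeSum w ω) (y + cubeSum w ω)

theorem boxAverage_eq_integral_update [DecidableEq ι] {w : ι → E}
    (hw : Summable fun i => ‖w i‖) {f : E → F} (hf : Continuous f) (i : ι) (z : E) :
    boxAverage w f z = ∫ t in (0 : ℝ)..1, boxAverage (update w i 0) f (z + t • w i) := by
  have hc := continuous_cubeSum hw
  have hc' := continuous_cubeSum (summable_norm_update hw i)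
  have hmp := measurePreserving_update_cube (ι := ι) i
  rw [← integral_unitInterval_eq fun t => boxAverage (update w i 0) f (z + t • w i)]
  have hF : Continuous fun ω => f (z + cubeSum w ω) := by fun_prop
  have h1 : boxAverage w f z = ∫ p : (ι → unitInterval) × unitInterval,
      f (z + cubeSum w (update p.1 i p.2)) ∂((cubeMeasure ι).prod volume) := by
    have := integral_map hmp.measurable.aemeasurable (μ := (cubeMeasure ι).prod volume)
      (hF.aestronglyMeasurable (μ := Measure.map _ _))
    rwa [hmp.map_eq] at this
  have hint : Integrable (fun p : (ι → unitInterval) × unitInterval =>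
      f (z + cubeSum w (update p.1 i p.2))) ((cubeMeasure ι).prod volume) := by
    refine Continuous.integrable_of_hasCompactSupport ?_ (.of_compactSpace _)
    simp only [cubeSum_update hw]
    fun_prop
  rw [h1, integral_prod_symm _ hint]
  simp only [boxAverage, cubeSum_update hw, add_assoc, add_comm (cubeSum _ _)]

/-- Along the side `w i` the average is the integral of a continuous function `G` over the moving
window `[t, t + 1]`, so the fundamental theorem of calculus differentiates it with no
differentiability of `f`. -/
theorem hasLineDerivAt_boxAverage [CompleteSpace F] [DecidableEq ι] {w : ι → E}
    (hw : Summable fun i => ‖w i‖) {f : E → F} {K : ℝ≥0} (hf : LipschitzWith K f) (i : ι)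
    (z : E) :
    HasLineDerivAt ℝ (boxAverage w f)
      (boxAverage (update w i 0) (fun x => f (x + w i) - f x) z) z (w i) := by
  have hw' := summable_norm_update hw i
  set g := boxAverage (update w i 0) f with hg
  have hgc : Continuous g := (hf.boxAverage hw').continuous
  set G : ℝ → F := fun t => g (z + t • w i) with hG
  have hGc : Continuous G := by fun_prop
  have h1 : ∀ t : ℝ, boxAverage w f (z + t • w i) =
      (∫ s in (0 : ℝ)..(t + 1), G s) - ∫ s in (0 : ℝ)..t, G s := by
    intro t
    rw [boxAverage_eq_integral_update hw hf.continuous i,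
      intervalIntegral.integral_interval_sub_left (hGc.intervalIntegrable _ _)
        (hGc.intervalIntegrable _ _)]
    have := intervalIntegral.integral_comp_add_right (a := 0) (b := 1) G t
    rw [zero_add, add_comm 1 t] at this
    rw [← this]
    congr 1 with s
    simp only [hG, hg, add_smul]
    congr 1
    abel
  have h2 : boxAverage (update w i 0) (fun x => f (x + w i) - f x) z = G (0 + 1) - G 0 := by
    have e : boxAverage (update w i 0) (fun x => f (x + w i) - f x) z =
        g (z + w i) - g z := by
      simp only [hg, boxAverage]
      rw [← integral_sub (integrable_comp_cubeSum hw' hf.continuous _)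
        (integrable_comp_cubeSum hw' hf.continuous _)]
      congr! 4
      abel
    simp [e, hG]
  have hder : ∀ x : ℝ, HasDerivAt (fun t => ∫ s in (0 : ℝ)..t, G s) (G x) x := fun x =>
    intervalIntegral.integral_hasDerivAt_right (hGc.intervalIntegrable _ _)
      hGc.aestronglyMeasurable.stronglyMeasurableAtFilter hGc.continuousAt
  unfold HasLineDerivAt
  simp only [h1, h2]
  exact ((hder (0 + 1)).comp_add_const 0 1).sub (hder 0)

end BoxAverage

/-! ### Additivity of line derivatives in the direction. -/

section LineDeriv

variable {E F : Type*} [NormedAddCommGroup E] [NormedSpace ℝ E]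
  [NormedAddCommGroup F] [NormedSpace ℝ F]

theorem HasLineDerivAt.hasDerivAt_add_smul {f : E → F} {f' : F} {y v : E} {s : ℝ}
    (h : HasLineDerivAt ℝ f f' (y + s • v) v) : HasDerivAt (fun t : ℝ => f (y + t • v)) f' s := by
  have h' : HasDerivAt (fun t : ℝ => f (y + s • v + t • v)) f' (s + -s) := by
    rw [add_neg_cancel]
    exact h
  convert! h'.comp_add_const s (-s) using 2 with t
  rw [add_smul, neg_smul]
  congr 1
  abel

/-- Line derivatives are additive in the direction if those in one of the two directions exist
everywhere and depend in a Lipschitz way on the point. -/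
theorem HasLineDerivAt.add_direction {f g : E → F} {f' : F} {z h v : E} {K : ℝ≥0}
    (hh : HasLineDerivAt ℝ f f' z h) (hv : ∀ y, HasLineDerivAt ℝ f (g y) y v)
    (hg : LipschitzWith K g) : HasLineDerivAt ℝ f (f' + g z) z (h + v) := by
  -- The error of replacing the increment along `t • v` by its linear part at `z`. The mean value
  -- inequality makes it `O(t ^ 2)`, so its derivative at `0` vanishes.
  set r : ℝ → F := fun t => f (z + t • h + t • v) - f (z + t • h) - t • g z with hr
  have hbound : ∀ t : ℝ, ‖r t‖ ≤ K * (‖h‖ + ‖v‖) * ‖t‖ ^ 2 := by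
    intro t
    have hd : ∀ s ∈ Set.uIcc 0 t, HasDerivWithinAt
        (fun s : ℝ => f (z + t • h + s • v) - s • g z)
        (g (z + t • h + s • v) - (1 : ℝ) • g z) (Set.uIcc 0 t) s := fun s _ =>
      ((hv _).hasDerivAt_add_smul.sub ((hasDerivAt_id s).smul_const (g z))).hasDerivWithinAt
    have hb : ∀ s ∈ Set.uIcc 0 t, ‖g (z + t • h + s • v) - (1 : ℝ) • g z‖ ≤
        K * ((‖h‖ + ‖v‖) * ‖t‖) := by
      intro s hs
      have hst : ‖s‖ ≤ ‖t‖ := by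
        simpa using Set.abs_sub_left_of_mem_uIcc hs
      rw [one_smul, ← dist_eq_norm]
      refine (hg.dist_le_mul _ _).trans ?_
      gcongr
      rw [dist_eq_norm]
      calc ‖z + t • h + s • v - z‖ = ‖t • h + s • v‖ := by congr 1; abel
        _ ≤ ‖t‖ * ‖h‖ + ‖s‖ * ‖v‖ := by
            simpa only [norm_smul] using norm_add_le (t • h) (s • v)
        _ ≤ ‖t‖ * ‖h‖ + ‖t‖ * ‖v‖ := by gcongr
        _ = (‖h‖ + ‖v‖) * ‖t‖ := by ring
    have := (convex_uIcc 0 t).norm_image_sub_le_of_norm_hasDerivWithin_le hd hb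
      Set.left_mem_uIcc Set.right_mem_uIcc
    calc ‖r t‖ = ‖f (z + t • h + t • v) - t • g z - (f (z + t • h + (0 : ℝ) • v)
          - (0 : ℝ) • g z)‖ := by
          simp only [hr, zero_smul, add_zero, sub_zero]
          congr 1
          abel
      _ ≤ _ := this
      _ = _ := by rw [sub_zero]; ring
  have hr0 : HasDerivAt r 0 0 := by
    have : r =O[𝓝 0] fun t : ℝ => ‖t - 0‖ ^ 2 :=
      Asymptotics.IsBigO.of_bound (K * (‖h‖ + ‖v‖)) (Eventually.of_forall fun t => by
        simpa using hbound t)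
    simpa using (this.hasFDerivAt one_lt_two).hasDerivAt
  have hsum := (hh.add hr0).add ((hasDerivAt_id (0 : ℝ)).smul_const (g z))
  rw [add_zero, one_smul] at hsum
  unfold HasLineDerivAt
  convert! hsum using 2 with t
  simp only [hr, Pi.add_apply, id, smul_add]
  rw [← add_assoc]
  abel

end LineDeriv

/-! ### Algebra and locality of functions with Lipschitz partials. -/

/-- All iterated partial derivatives exist and are Lipschitz on the whole space. -/
structure HasLipschitzPartials (f : EllTwo → ℂ) : Prop where
  lipschitz : ∀ l : List (ℕ × Bool), ∃ K, LipschitzWith K (iterRealPartial l f)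
  lineDifferentiableAt : ∀ (l : List (ℕ × Bool)) (d : ℕ × Bool) (z : EllTwo),
    LineDifferentiableAt ℝ (iterRealPartial l f) z (coordDir d)

theorem iterRealPartial_append (l m : List (ℕ × Bool)) (f : EllTwo → ℂ) :
    iterRealPartial (l ++ m) f = iterRealPartial l (iterRealPartial m f) := by
  induction l with
  | nil => rfl
  | cons d l ih => simp only [List.cons_append, iterRealPartial, ih]

namespace HasLipschitzPartials

variable {f g : EllTwo → ℂ}

theorem hasLineDerivAt (hf : HasLipschitzPartials f) (l : List (ℕ × Bool)) (d : ℕ × Bool)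
    (z : EllTwo) :
    HasLineDerivAt ℝ (iterRealPartial l f) (iterRealPartial (d :: l) f z) z (coordDir d) :=
  (hf.lineDifferentiableAt l d z).hasLineDerivAt

theorem realPartial (hf : HasLipschitzPartials f) (d : ℕ × Bool) :
    HasLipschitzPartials (realPartial d f) := by
  have e : ∀ l, iterRealPartial l (_root_.realPartial d f) = iterRealPartial (l ++ [d]) f :=
    fun l => (iterRealPartial_append l [d] f).symm
  exact ⟨fun l => e l ▸ hf.lipschitz _, fun l => e l ▸ hf.lineDifferentiableAt _⟩

theorem iterRealPartial_add (hf : HasLipschitzPartials f) (hg : HasLipschitzPartials g)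
    (l : List (ℕ × Bool)) :
    iterRealPartial l (fun z => f z + g z) =
      fun z => iterRealPartial l f z + iterRealPartial l g z := by
  induction l with
  | nil => rfl
  | cons d l ih =>
    ext1 z
    rw [iterRealPartial, ih]
    exact HasLineDerivAt.lineDeriv (HasDerivAt.add (hf.hasLineDerivAt l d z)
      (hg.hasLineDerivAt l d z))

theorem add (hf : HasLipschitzPartials f) (hg : HasLipschitzPartials g) :
    HasLipschitzPartials fun z => f z + g z where
  lipschitz l := by
    obtain ⟨K, hK⟩ := hf.lipschitz l
    obtain ⟨L, hL⟩ := hg.lipschitz l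
    exact ⟨K + L, iterRealPartial_add hf hg l ▸ hK.add hL⟩
  lineDifferentiableAt l d z := by
    rw [iterRealPartial_add hf hg l]
    exact HasLineDerivAt.lineDifferentiableAt (HasDerivAt.add (hf.hasLineDerivAt l d z)
      (hg.hasLineDerivAt l d z))

theorem iterRealPartial_const_mul (hf : HasLipschitzPartials f) (c : ℂ)
    (l : List (ℕ × Bool)) :
    iterRealPartial l (fun z => c * f z) = fun z => c * iterRealPartial l f z := by
  induction l with
  | nil => rfl
  | cons d l ih =>
    ext1 z
    rw [iterRealPartial, ih]
    exact HasLineDerivAt.lineDeriv (HasDerivAt.const_mul c (hf.hasLineDerivAt l d z))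

theorem const_mul (hf : HasLipschitzPartials f) (c : ℂ) :
    HasLipschitzPartials fun z => c * f z where
  lipschitz l := by
    obtain ⟨K, hK⟩ := hf.lipschitz l
    rw [iterRealPartial_const_mul hf c l]
    exact ⟨_, (lipschitzWith_smul c).comp hK⟩
  lineDifferentiableAt l d z := by
    rw [iterRealPartial_const_mul hf c l]
    exact HasLineDerivAt.lineDifferentiableAt (HasDerivAt.const_mul c (hf.hasLineDerivAt l d z))

theorem sum {ι : Type*} (s : Finset ι) {F : ι → EllTwo → ℂ} (hg : HasLipschitzPartials g)
    (hF : ∀ i, HasLipschitzPartials (F i)) :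
    HasLipschitzPartials fun z => g z + ∑ i ∈ s, F i z := by
  classical
  induction s using Finset.induction_on with
  | empty => simpa using hg
  | insert i s hi ih =>
    simp only [Finset.sum_insert hi, add_left_comm (g _)]
    exact (hF i).add ih

theorem wirt (hf : HasLipschitzPartials f) (j : ℕ) : HasLipschitzPartials (wirt j f) := by
  have := ((hf.realPartial (j, false)).add
    ((hf.realPartial (j, true)).const_mul (-Complex.I))).const_mul (1 / 2)
  simp only [neg_mul, ← sub_eq_add_neg] at this
  exact this

theorem wirtBar (hf : HasLipschitzPartials f) (j : ℕ) : HasLipschitzPartials (wirtBar j f) :=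
  ((hf.realPartial (j, false)).add
    ((hf.realPartial (j, true)).const_mul Complex.I)).const_mul (1 / 2)

end HasLipschitzPartials

theorem List.foldr_iterate_induction {X : Type*} {P : X → Prop} {T : ℕ → X → X}
    (hT : ∀ j x, P x → P (T j x)) (a : ℕ → ℕ) (l : List ℕ) {x : X} (hx : P x) :
    P (l.foldr (fun j y => (T j)^[a j] y) x) := by
  induction l with
  | nil => exact hx
  | cons j l ih => exact Function.Iterate.rec P ih (hT j) (a j)

theorem realPartial_congr {U : Set EllTwo} (hU : IsOpen U) {f g : EllTwo → ℂ}
    (h : Set.EqOn f g U) (d : ℕ × Bool) : Set.EqOn (realPartial d f) (realPartial d g) U :=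
  fun _ hz => (h.eventuallyEq_of_mem (hU.mem_nhds hz)).lineDeriv_eq

theorem iterRealPartial_congr {U : Set EllTwo} (hU : IsOpen U) {f g : EllTwo → ℂ}
    (h : Set.EqOn f g U) (l : List (ℕ × Bool)) :
    Set.EqOn (iterRealPartial l f) (iterRealPartial l g) U := by
  induction l with
  | nil => exact h
  | cons d l ih => exact realPartial_congr hU ih d

theorem wirt_congr {U : Set EllTwo} (hU : IsOpen U) {f g : EllTwo → ℂ}
    (h : Set.EqOn f g U) (j : ℕ) : Set.EqOn (wirt j f) (wirt j g) U := fun z hz => by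
  simp only [wirt, realPartial_congr hU h _ hz]

theorem wirtBar_congr {U : Set EllTwo} (hU : IsOpen U) {f g : EllTwo → ℂ}
    (h : Set.EqOn f g U) (j : ℕ) : Set.EqOn (wirtBar j f) (wirtBar j g) U := fun z hz => by
  simp only [wirtBar, realPartial_congr hU h _ hz]

/-! ### Square-summability of the gradient. -/

section GradientBound

theorem lp_single_eq_coordDir (j : ℕ) (c : ℂ) :
    (lp.single 2 j c : EllTwo) = c.re • coordDir (j, false) + c.im • coordDir (j, true) := by
  have h : ∀ (r : ℝ) (a : ℂ), (r • lp.single 2 j a : EllTwo) = lp.single 2 j (r • a) :=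
    fun r a => by
      have := (lp.single_smul (E := fun _ : ℕ => ℂ) 2 j (r : ℂ) a).symm
      rwa [Complex.coe_smul, Complex.coe_smul] at this
  simp only [coordDir, Bool.false_eq_true, if_false, if_true, h]
  rw [← lp.single_add]
  congr 1
  simp [Complex.re_add_im]

theorem norm_coordDir (d : ℕ × Bool) : ‖coordDir d‖ = 1 := by
  rw [coordDir, lp.norm_single (by norm_num)]
  split_ifs <;> simp

variable {f : EllTwo → ℂ}

theorem HasLipschitzPartials.hasLineDerivAt_sum_single (hf : HasLipschitzPartials f)
    (z : EllTwo) (c : ℕ → ℂ) (s : Finset ℕ) :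
    HasLineDerivAt ℝ f (∑ j ∈ s, ((c j).re • _root_.realPartial (j, false) f z +
      (c j).im • _root_.realPartial (j, true) f z)) z (∑ j ∈ s, (lp.single 2 j (c j) : EllTwo)) := by
  have key : ∀ (r : ℝ) (d : ℕ × Bool) {f' : ℂ} {h : EllTwo}, HasLineDerivAt ℝ f f' z h →
      HasLineDerivAt ℝ f (f' + r • _root_.realPartial d f z) z (h + r • coordDir d) := by
    intro r d f' h hh
    obtain ⟨K, hK⟩ := hf.lipschitz [d]
    exact hh.add_direction (fun y => (hf.hasLineDerivAt [] d y).smul r)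
      ((lipschitzWith_smul r).comp hK)
  induction s using Finset.induction_on with
  | empty => simpa using hasLineDerivAt_zero
  | insert j s hj ih =>
    rw [Finset.sum_insert hj, Finset.sum_insert hj, lp_single_eq_coordDir, add_comm,
      add_comm _ (∑ j ∈ s, lp.single 2 j (c j)), ← add_assoc, ← add_assoc]
    exact key _ _ (key _ _ ih)

theorem HasLipschitzPartials.norm_sum_realPartial_le (hf : HasLipschitzPartials f) {K : ℝ≥0}
    (hK : LipschitzWith K f) (z : EllTwo) (c : ℕ → ℂ) (s : Finset ℕ) :
    ‖∑ j ∈ s, ((c j).re • _root_.realPartial (j, false) f z +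
      (c j).im • _root_.realPartial (j, true) f z)‖ ≤ K * √(∑ j ∈ s, ‖c j‖ ^ 2) := by
  refine ((hf.hasLineDerivAt_sum_single z c s).le_of_lipschitz hK).trans_eq ?_
  have := lp.norm_sum_single (E := fun _ : ℕ => ℂ) (p := 2) (by norm_num) c s
  simp only [ENNReal.toReal_ofNat, Real.rpow_ofNat] at this
  rw [← this, Real.sqrt_sq (norm_nonneg _)]

theorem le_sq_of_le_mul_sqrt {A K : ℝ} (hA : 0 ≤ A) (h : A ≤ K * √A) :
    A ≤ K ^ 2 := by
  have h1 := Real.sq_sqrt hA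
  have h2 := Real.sqrt_nonneg A
  nlinarith [sq_nonneg (K - √A)]

/-- Testing the derivative on the gradient itself gives `A ≤ K * √A` for its square sum `A`. The
test direction has real coefficients, so the real and imaginary parts of `f` are treated separately,
whence the factor 2. -/
theorem HasLipschitzPartials.sum_sq_realPartial_le (hf : HasLipschitzPartials f) {K : ℝ≥0}
    (hK : LipschitzWith K f) (z : EllTwo) (s : Finset ℕ) :
    ∑ j ∈ s, (‖_root_.realPartial (j, false) f z‖ ^ 2 + ‖_root_.realPartial (j, true) f z‖ ^ 2)
      ≤ 2 * K ^ 2 := by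
  set p := fun j => _root_.realPartial (j, false) f z with hp
  set q := fun j => _root_.realPartial (j, true) f z with hq
  have hre : ∑ j ∈ s, ((p j).re ^ 2 + (q j).re ^ 2) ≤ (K : ℝ) ^ 2 := by
    refine le_sq_of_le_mul_sqrt (by positivity) ?_
    have h := (Complex.re_le_norm _).trans
      (hf.norm_sum_realPartial_le hK z (fun j => ⟨(p j).re, (q j).re⟩) s)
    simpa [Complex.sq_norm, Complex.normSq_apply, ← sq, ← hp, ← hq, p, q] using h
  have him : ∑ j ∈ s, ((p j).im ^ 2 + (q j).im ^ 2) ≤ (K : ℝ) ^ 2 := by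
    refine le_sq_of_le_mul_sqrt (by positivity) ?_
    have h := (Complex.im_le_norm _).trans
      (hf.norm_sum_realPartial_le hK z (fun j => ⟨(p j).im, (q j).im⟩) s)
    simpa [Complex.sq_norm, Complex.normSq_apply, ← sq, ← hp, ← hq, p, q] using h
  calc _ = ∑ j ∈ s, ((p j).re ^ 2 + (q j).re ^ 2) + ∑ j ∈ s, ((p j).im ^ 2 + (q j).im ^ 2) := by
        rw [← Finset.sum_add_distrib]
        refine Finset.sum_congr rfl fun j _ => ?_
        simp only [Complex.sq_norm, Complex.normSq_apply, p, q]
        ring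
    _ ≤ _ := by linarith

theorem sq_norm_wirt_add_sq_norm_wirtBar (f : EllTwo → ℂ) (j : ℕ) (z : EllTwo) :
    ‖wirt j f z‖ ^ 2 + ‖wirtBar j f z‖ ^ 2 =
      (‖realPartial (j, false) f z‖ ^ 2 + ‖realPartial (j, true) f z‖ ^ 2) / 2 := by
  simp only [wirt, wirtBar, norm_mul, mul_pow, Complex.sq_norm, Complex.normSq_apply,
    Complex.sub_re, Complex.sub_im, Complex.add_re, Complex.add_im, Complex.mul_re,
    Complex.mul_im, Complex.I_re, Complex.I_im]
  norm_num
  ring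

theorem HasLipschitzPartials.tsum_wirt_le (hf : HasLipschitzPartials f) {K : ℝ≥0}
    (hK : LipschitzWith K f) (z : EllTwo) :
    ∑' j : ℕ, (‖_root_.wirt j f z‖ₑ ^ 2 + ‖_root_.wirtBar j f z‖ₑ ^ 2) ≤ (K : ℝ≥0∞) ^ 2 := by
  refine ENNReal.summable.tsum_le_of_sum_le fun s => ?_
  have e : ∀ j, ‖_root_.wirt j f z‖ₑ ^ 2 + ‖_root_.wirtBar j f z‖ₑ ^ 2 = ENNReal.ofReal
      ((‖_root_.realPartial (j, false) f z‖ ^ 2 + ‖_root_.realPartial (j, true) f z‖ ^ 2) / 2) := by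
    intro j
    rw [← sq_norm_wirt_add_sq_norm_wirtBar, ENNReal.ofReal_add (by positivity) (by positivity),
      ENNReal.ofReal_pow (norm_nonneg _), ENNReal.ofReal_pow (norm_nonneg _), ofReal_norm,
      ofReal_norm]
  simp only [e]
  rw [← ENNReal.ofReal_sum_of_nonneg fun j _ => by positivity, ← Finset.sum_div,
    ← ENNReal.ofReal_coe_nnreal, ← ENNReal.ofReal_pow (NNReal.coe_nonneg K)]
  exact ENNReal.ofReal_le_ofReal (by linarith [hf.sum_sq_realPartial_le hK z s])

end GradientBound

/-! ### From Lipschitz partials near uniformly included sets to `IsCInftyFInfty`. -/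

/-- Around every uniformly included subset of `V`, the function agrees with one all of whose
iterated partial derivatives are Lipschitz. -/
def LocallyHasLipschitzPartials (V : Set EllTwo) (f : EllTwo → ℂ) : Prop :=
  ∀ S, UniformlyIncluded S V → ∃ U, IsOpen U ∧ S ⊆ U ∧
    ∃ g, HasLipschitzPartials g ∧ Set.EqOn f g U

namespace LocallyHasLipschitzPartials

variable {V : Set EllTwo} {f : EllTwo → ℂ}

theorem wirt (hf : LocallyHasLipschitzPartials V f) (j : ℕ) :
    LocallyHasLipschitzPartials V (wirt j f) := fun S hS => by
  obtain ⟨U, hU, hSU, g, hg, hfg⟩ := hf S hS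
  exact ⟨U, hU, hSU, _, hg.wirt j, wirt_congr hU hfg j⟩

theorem wirtBar (hf : LocallyHasLipschitzPartials V f) (j : ℕ) :
    LocallyHasLipschitzPartials V (wirtBar j f) := fun S hS => by
  obtain ⟨U, hU, hSU, g, hg, hfg⟩ := hf S hS
  exact ⟨U, hU, hSU, _, hg.wirtBar j, wirtBar_congr hU hfg j⟩

theorem isCk (hf : LocallyHasLipschitzPartials V f)
    (hV : ∀ z ∈ V, UniformlyIncluded {z} V) (k : ℕ) : IsCk k V f := by
  refine ⟨fun l _ d z hz => ?_, fun l _ z hz => ?_⟩ <;>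
    obtain ⟨U, hU, hSU, g, hg, hfg⟩ := hf _ (hV z hz) <;>
    have he := (iterRealPartial_congr hU hfg l).eventuallyEq_of_mem
      (hU.mem_nhds (hSU rfl))
  · exact he.lineDifferentiableAt_iff.2 (hg.lineDifferentiableAt l d z)
  · obtain ⟨K, hK⟩ := hg.lipschitz l
    exact (hK.continuous.continuousAt.congr he.symm).continuousWithinAt

theorem isC1F (hf : LocallyHasLipschitzPartials V f)
    (hV : ∀ z ∈ V, UniformlyIncluded {z} V) : IsC1F V f := by
  refine ⟨hf.isCk hV 1, fun S hS => ?_⟩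
  obtain ⟨U, hU, hSU, g, hg, hfg⟩ := hf S hS
  obtain ⟨K, hK : LipschitzWith K g⟩ := hg.lipschitz []
  obtain ⟨C, hC⟩ := (hK.isBounded_image hS.2.1).exists_norm_le
  refine lt_of_le_of_lt (b := ENNReal.ofReal C + (K : ℝ≥0∞) ^ 2) (iSup₂_le fun z hz => ?_)
    (by finiteness)
  have hzU := hSU hz
  simp only [hfg hzU, wirt_congr hU hfg _ hzU, wirtBar_congr hU hfg _ hzU]
  gcongr
  · rw [← ofReal_norm]
    exact ENNReal.ofReal_le_ofReal (hC _ ⟨z, hz, rfl⟩)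
  · exact hg.tsum_wirt_le hK z

theorem isCInftyFInfty (hf : LocallyHasLipschitzPartials V f)
    (hV : ∀ z ∈ V, UniformlyIncluded {z} V) : IsCInftyFInfty V f :=
  ⟨hf.isCk hV, fun α β => isC1F
    (List.foldr_iterate_induction (P := LocallyHasLipschitzPartials V) (fun j _ h => h.wirt j) α _
      (List.foldr_iterate_induction (P := LocallyHasLipschitzPartials V)
        (fun j _ h => h.wirtBar j) β _ hf)) hV⟩

end LocallyHasLipschitzPartials

/-! ### Smoothing by boxes with infinitely many sides in each direction. -/

section SpanningFamily

variable {ι : Type*}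

/-- A summable family in which each coordinate direction occurs infinitely often, up to nonzero
real factors. -/
structure IsSpanningFamily (w : ι → EllTwo) : Prop where
  summable : Summable fun i => ‖w i‖
  infinite : ∀ d, {i | ∃ c : ℝ, c ≠ 0 ∧ w i = c • coordDir d}.Infinite

/-- Each differentiation uses up one side. Infinite multiplicity is what survives this loss. -/
theorem IsSpanningFamily.update_zero [DecidableEq ι] {w : ι → EllTwo} (hw : IsSpanningFamily w)
    (i : ι) : IsSpanningFamily (update w i 0) where
  summable := summable_norm_update hw.summable i
  infinite d := by
    refine ((hw.infinite d).sdiff (Set.finite_singleton i)).mono ?_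
    rintro j ⟨⟨c, hc, hj⟩, hji⟩
    exact ⟨c, hc, by rw [update_of_ne hji, hj]⟩

theorem exists_isSpanningFamily {ε : ℝ} (hε : 0 < ε) :
    ∃ w : (ℕ × Bool) × ℕ → EllTwo, IsSpanningFamily w ∧ ∑' i, ‖w i‖ ≤ ε := by
  obtain ⟨a, ha, c, hac, hc⟩ := posSumOfEncodable hε ((ℕ × Bool) × ℕ)
  have hn : ∀ i, ‖a i • coordDir i.1‖ = a i := fun i => by
    rw [norm_smul, norm_coordDir, mul_one, Real.norm_of_nonneg (ha i).le]
  refine ⟨fun i => a i • coordDir i.1, ⟨?_, fun d => ?_⟩, ?_⟩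
  · simpa only [hn] using hac.summable
  · exact (Set.infinite_range_of_injective (Prod.mk_right_injective d)).mono
      (Set.range_subset_iff.2 fun k => ⟨a (d, k), (ha _).ne', rfl⟩)
  · simpa only [hn, hac.tsum_eq] using hc

theorem boxAverage_eq_of_forall_dist_le {w : ι → EllTwo} (hw : Summable fun i => ‖w i‖)
    {f : EllTwo → ℝ} {z : EllTwo} {c : ℝ} (h : ∀ y, dist z y ≤ ∑' i, ‖w i‖ → f y = c) :
    boxAverage w f z = c := by
  rw [boxAverage, integral_congr_ae (g := fun _ => c) (ae_of_all _ fun ω => h _ ?_)]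
  · simp
  · simpa [dist_eq_norm] using norm_cubeSum_le hw ω

variable [Countable ι]

theorem IsSpanningFamily.exists_hasLineDerivAt {w : ι → EllTwo} (hw : IsSpanningFamily w)
    {f : EllTwo → ℂ} {K : ℝ≥0} (hf : LipschitzWith K f) (d : ℕ × Bool) :
    ∃ (w' : ι → EllTwo) (f' : EllTwo → ℂ) (K' : ℝ≥0), IsSpanningFamily w' ∧
      LipschitzWith K' f' ∧
      ∀ z, HasLineDerivAt ℝ (boxAverage w f) (boxAverage w' f' z) z (coordDir d) := by
  classical
  obtain ⟨i, c, hc, hi⟩ := (hw.infinite d).nonempty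
  refine ⟨update w i 0, fun x => c⁻¹ • (f (x + w i) - f x), _, hw.update_zero i,
    (lipschitzWith_smul c⁻¹).comp ((hf.comp (LipschitzWith.id.add (.const (w i)))).sub hf),
    fun z => ?_⟩
  have h := (hasLineDerivAt_boxAverage hw.summable hf i z).smul c⁻¹
  have hv : c⁻¹ • w i = coordDir d := by rw [hi, inv_smul_smul₀ hc]
  rw [hv] at h
  have e : boxAverage (update w i 0) (fun x => c⁻¹ • (f (x + w i) - f x)) z =
      c⁻¹ • boxAverage (update w i 0) (fun x => f (x + w i) - f x) z :=
    integral_smul c⁻¹ fun ω => f (z + cubeSum (update w i 0) ω + w i) -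
      f (z + cubeSum (update w i 0) ω)
  rw [e]
  exact h

theorem IsSpanningFamily.exists_iterRealPartial_eq {w : ι → EllTwo} (hw : IsSpanningFamily w)
    {f : EllTwo → ℂ} {K : ℝ≥0} (hf : LipschitzWith K f) (l : List (ℕ × Bool)) :
    ∃ (w' : ι → EllTwo) (f' : EllTwo → ℂ) (K' : ℝ≥0), IsSpanningFamily w' ∧
      LipschitzWith K' f' ∧ iterRealPartial l (boxAverage w f) = boxAverage w' f' := by
  induction l with
  | nil => exact ⟨w, f, K, hw, hf, rfl⟩
  | cons d l ih =>
    obtain ⟨w', f', K', hw', hf', e⟩ := ih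
    obtain ⟨w'', f'', K'', hw'', hf'', h⟩ := hw'.exists_hasLineDerivAt hf' d
    refine ⟨w'', f'', K'', hw'', hf'', funext fun z => ?_⟩
    rw [iterRealPartial, e]
    exact (h z).lineDeriv

theorem IsSpanningFamily.hasLipschitzPartials {w : ι → EllTwo} (hw : IsSpanningFamily w)
    {f : EllTwo → ℂ} {K : ℝ≥0} (hf : LipschitzWith K f) :
    HasLipschitzPartials (boxAverage w f) where
  lipschitz l := by
    obtain ⟨w', f', K', hw', hf', e⟩ := hw.exists_iterRealPartial_eq hf l
    exact ⟨K', e ▸ hf'.boxAverage hw'.summable⟩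
  lineDifferentiableAt l d z := by
    obtain ⟨w', f', K', hw', hf', e⟩ := hw.exists_iterRealPartial_eq hf l
    obtain ⟨w'', f'', K'', hw'', hf'', h⟩ := hw'.exists_hasLineDerivAt hf' d
    exact e ▸ (h z).lineDifferentiableAt

theorem IsSpanningFamily.hasLipschitzPartials_ofReal {w : ι → EllTwo} (hw : IsSpanningFamily w)
    {f : EllTwo → ℝ} {K : ℝ≥0} (hf : LipschitzWith K f) :
    HasLipschitzPartials fun z => ((boxAverage w f z : ℝ) : ℂ) := by
  have e : (fun z => ((boxAverage w f z : ℝ) : ℂ)) = boxAverage w fun x => (f x : ℂ) :=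
    funext fun z => integral_ofReal.symm
  rw [e]
  exact hw.hasLipschitzPartials (Complex.isometry_ofReal.lipschitz.comp hf)

theorem norm_sub_le_boxAverage_norm {w : ι → EllTwo} (hw : Summable fun i => ‖w i‖)
    (z : EllTwo) : ‖z‖ - ∑' i, ‖w i‖ ≤ boxAverage w (fun x => ‖x‖) z := by
  have := integral_mono (integrable_const (μ := cubeMeasure ι) (‖z‖ - ∑' i, ‖w i‖))
    (integrable_comp_cubeSum hw continuous_norm z) fun ω => ?_
  · simpa [boxAverage] using this
  · have h1 := norm_sub_le (z + cubeSum w ω) (cubeSum w ω)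
    rw [add_sub_cancel_right] at h1
    have h2 := norm_cubeSum_le hw ω
    simp only
    linarith

end SpanningFamily

/-! ### Smooth cutoffs and a smooth norm. -/

/-- Average of a Lipschitz cutoff: it is `1` near `A`, and it vanishes away from `A`. -/
theorem exists_smooth_cutoff (A : Set EllTwo) {δ : ℝ} (hδ : 0 < δ) :
    ∃ u : EllTwo → ℝ, HasLipschitzPartials (fun z => (u z : ℂ)) ∧ (∀ z, 0 ≤ u z) ∧
      (∀ z, Metric.infEDist z A ≤ ENNReal.ofReal (δ / 2) → u z = 1) ∧
      ∀ z, ENNReal.ofReal (3 * δ) < Metric.infEDist z A → u z = 0 := by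
  obtain ⟨w, hw, hwδ⟩ := exists_isSpanningFamily (half_pos hδ)
  -- `f` is `1` within `δ` of `A` and `0` at distance `2 * δ` or more. The box moves points by at
  -- most `δ / 2`, which leaves `1` within `δ / 2` and `0` beyond `5 * δ / 2`, hence beyond `3 * δ`.
  set f : EllTwo → ℝ := fun z => thickenedIndicator hδ (Metric.cthickening δ A) z with hf
  have hfl : LipschitzWith δ.toNNReal⁻¹ f := lipschitzWith_thickenedIndicator hδ _
  have hed : ∀ {z y : EllTwo}, dist z y ≤ ∑' i, ‖w i‖ → edist z y ≤ ENNReal.ofReal (δ / 2) :=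
    fun h => by
      rw [edist_dist]
      exact ENNReal.ofReal_le_ofReal (h.trans hwδ)
  refine ⟨boxAverage w f, hw.hasLipschitzPartials_ofReal hfl,
    fun z => integral_nonneg fun ω => NNReal.coe_nonneg _, fun z hz => ?_, fun z hz => ?_⟩ <;>
    refine boxAverage_eq_of_forall_dist_le hw.summable fun y hy => ?_
  · have : y ∈ Metric.cthickening δ A := by
      rw [Metric.mem_cthickening_iff]
      calc Metric.infEDist y A ≤ Metric.infEDist z A + edist y z :=
            Metric.infEDist_le_infEDist_add_edist
        _ ≤ ENNReal.ofReal (δ / 2) + ENNReal.ofReal (δ / 2) :=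
            add_le_add hz (edist_comm z y ▸ hed hy)
        _ = ENNReal.ofReal δ := by
            rw [← ENNReal.ofReal_add (by positivity) (by positivity), add_halves]
    simp only [hf, thickenedIndicator_one hδ _ this, NNReal.coe_one]
  · have : y ∉ Metric.thickening δ (Metric.cthickening δ A) := fun h => by
      have h2 := Metric.thickening_cthickening_subset δ hδ.le A h
      rw [Metric.mem_thickening_iff_infEDist_lt] at h2
      refine hz.not_ge ?_
      calc Metric.infEDist z A ≤ Metric.infEDist y A + edist z y :=
            Metric.infEDist_le_infEDist_add_edist
        _ ≤ ENNReal.ofReal (δ + δ) + ENNReal.ofReal (δ / 2) := add_le_add h2.le (hed hy)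
        _ = ENNReal.ofReal (δ + δ + δ / 2) := by
            rw [← ENNReal.ofReal_add (by positivity) (by positivity)]
        _ ≤ ENNReal.ofReal (3 * δ) := ENNReal.ofReal_le_ofReal (by linarith)
    simp only [hf, thickenedIndicator_zero hδ _ this, NNReal.coe_zero]

/-- A smooth substitute for the norm. -/
theorem exists_smooth_norm : ∃ u : EllTwo → ℝ, HasLipschitzPartials (fun z => (u z : ℂ)) ∧
    ∀ z, 0 ≤ u z ∧ ‖z‖ - 1 ≤ u z := by
  obtain ⟨w, hw, hw1⟩ := exists_isSpanningFamily one_pos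
  exact ⟨boxAverage w fun x => ‖x‖, hw.hasLipschitzPartials_ofReal lipschitzWith_one_norm,
    fun z => ⟨integral_nonneg fun ω => norm_nonneg _,
      by linarith [norm_sub_le_boxAverage_norm hw.summable z]⟩⟩

/-! ### Distance to the frontier and the exhaustion function. -/

theorem uniformlyIncluded_iff {S V : Set EllTwo} : UniformlyIncluded S V ↔
    S ⊆ V ∧ Bornology.IsBounded S ∧ 0 < ⨅ z ∈ S, Metric.infEDist z (frontier V) :=
  Iff.rfl

theorem IsOpen.infEDist_frontier_pos {V : Set EllTwo} (hV : IsOpen V) {z : EllTwo} (hz : z ∈ V) :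
    0 < Metric.infEDist z (frontier V) := by
  rw [Metric.infEDist_pos_iff_notMem_closure, isClosed_frontier.closure_eq, hV.frontier_eq]
  exact fun h => h.2 hz

theorem uniformlyIncluded_singleton {V : Set EllTwo} (hV : IsOpen V) {z : EllTwo} (hz : z ∈ V) :
    UniformlyIncluded {z} V := by
  rw [uniformlyIncluded_iff]
  exact ⟨Set.singleton_subset_iff.2 hz, Bornology.isBounded_singleton,
    by simpa using hV.infEDist_frontier_pos hz⟩

theorem exists_ofReal_three_div_lt {ε : ℝ≥0∞} (hε : 0 < ε) :
    ∃ m : ℕ, ENNReal.ofReal (3 * (1 / ((m : ℝ) + 1))) < ε := by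
  have h : Tendsto (fun m : ℕ => ENNReal.ofReal (3 * (1 / ((m : ℝ) + 1)))) atTop (𝓝 0) := by
    have := ENNReal.tendsto_ofReal ((tendsto_one_div_add_atTop_nhds_zero_nat (𝕜 := ℝ)).const_mul 3)
    simpa using this
  exact (h.eventually_lt_const hε).exists

theorem theorem3p2 (V : Set EllTwo) (hVo : IsOpen V) (hVn : V.Nonempty) :
    ∃ η : EllTwo → ℝ, IsExhaustion V η ∧ IsCInftyFInfty V (fun z => (η z : ℂ)) := by
  have hδ : ∀ n : ℕ, (0 : ℝ) < 1 / ((n : ℝ) + 1) := fun n => Nat.one_div_pos_of_nat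
  choose u hu hu0 hu1 hu2 using fun n : ℕ => exists_smooth_cutoff (frontier V) (hδ n)
  obtain ⟨v, hv, hv1⟩ := exists_smooth_norm
  have hδm : ∀ {m n : ℕ}, m ≤ n → 1 / ((n : ℝ) + 1) ≤ 1 / ((m : ℝ) + 1) :=
    fun h => Nat.one_div_le_one_div h
  -- At distance more than `3 / (m + 1)` from the frontier only the first `m` cutoffs can be
  -- nonzero. If the frontier is empty the distance is `∞` and all of them vanish.
  have hvanish : ∀ (m : ℕ) (z : EllTwo),
      ENNReal.ofReal (3 * (1 / ((m : ℝ) + 1))) < Metric.infEDist z (frontier V) →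
      ∀ n ∉ Finset.range m, u n z = 0 := fun m z hz n hn =>
    hu2 n z (lt_of_le_of_lt (ENNReal.ofReal_le_ofReal
      (mul_le_mul_of_nonneg_left (hδm (by simpa using hn)) (by norm_num))) hz)
  refine ⟨fun z => v z + ∑' n, u n z, fun t => ?_, ?_⟩
  · obtain ⟨N, hN⟩ := exists_nat_ge t
    rw [uniformlyIncluded_iff]
    refine ⟨fun z hz => hz.1, ?_, ?_⟩
    · refine isBounded_iff_forall_norm_le.2 ⟨t + 1, fun z hz => ?_⟩
      have h1 : 0 ≤ ∑' n, u n z := tsum_nonneg fun n => hu0 n z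
      have h2 := (hv1 z).2
      have h3 : v z + ∑' n, u n z ≤ t := hz.2
      linarith
    -- Within `1 / (2 * (N + 1))` of the frontier the cutoffs `0, …, N` all equal `1`, so the sum is
    -- at least `N + 1 > t`.
    · refine lt_of_lt_of_le (ENNReal.ofReal_pos.2 (half_pos (hδ N)))
        (le_iInf₂ fun z hz => le_of_not_gt fun hlt => ?_)
      obtain ⟨m, hm⟩ := exists_ofReal_three_div_lt (hVo.infEDist_frontier_pos hz.1)
      -- Needed because a divergent `tsum` would be `0`. Each point of `V` has positive distance to
      -- the frontier, so its series is finite.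
      have hs : Summable fun n => u n z := summable_of_ne_finset_zero (hvanish m z hm)
      have h1 : ∑ n ∈ Finset.range (N + 1), u n z = N + 1 := by
        rw [Finset.sum_congr rfl fun n hn => hu1 n z (hlt.le.trans (ENNReal.ofReal_le_ofReal
          (div_le_div_of_nonneg_right (hδm (Finset.mem_range_succ_iff.1 hn)) (by norm_num))))]
        simp
      have h2 := hs.sum_le_tsum (Finset.range (N + 1)) fun n _ => hu0 n z
      have h3 := (hv1 z).1
      have h4 : v z + ∑' n, u n z ≤ t := hz.2
      linarith
  · refine LocallyHasLipschitzPartials.isCInftyFInfty (fun S hS => ?_)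
      fun z hz => uniformlyIncluded_singleton hVo hz
    obtain ⟨m, hm⟩ := exists_ofReal_three_div_lt (uniformlyIncluded_iff.1 hS).2.2
    -- On this open neighbourhood of `S` the series equals its partial sum over `Finset.range m`,
    -- which has Lipschitz partials on the whole space.
    refine ⟨{z | ENNReal.ofReal (3 * (1 / ((m : ℝ) + 1))) < Metric.infEDist z (frontier V)},
      isOpen_lt continuous_const Metric.continuous_infEDist,
      fun z hz => hm.trans_le (iInf₂_le z hz), _, hv.sum (Finset.range m) hu, fun z hz => ?_⟩
    simp only
    rw [tsum_eq_sum (hvanish m z hz)]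
    push_cast
    rfl

end
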